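/- There are $n$ prisoners and $n$ drawers, both numbered $1,\dots,n$, and each drawer contains one of the numbers $1,\dots,n$, all different. A strategy consists of two parts. First, a spy inspects the whole initial placement and swaps the contents of two drawers chosen as a function of it. Then each prisoner, without any further communication, opens drawers one after another, where the next drawer depends only on the prisoner's own number and on the numbers this prisoner has seen so far. A strategy succeeds with $k$ drawers if, for every initial placement, after the spy's swap every prisoner finds their own number among the first $k$ drawers they open. (Existence) There are integers $k_n$ with $k_n=\frac{n\ln\ln n}{\ln n}(1+o(1))$ as $n\to\infty$ such that for every $n\ge 2$ there is a strategy, in which the spy always swaps the contents of two different drawers, that succeeds with $k_n$ drawers. (Optimality up to a factor of two) There is a function $g(n)=o(1)$, independent of the strategy, such that for every $n\ge 2$, every strategy (even if the spy may also leave the placement unchanged) that succeeds with $k$ drawers has $k\ge\frac{n\ln\ln n}{2\ln n}(1+g(n))$. -/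

import Mathlib

open Filter Topology

/-- A placement of the `n` numbers into the `n` drawers: drawer `d` contains the number `σ d`.
Prisoners, numbers and drawers are all labelled by `Fin n`. -/
abbrev Placement (n : ℕ) : Type := Equiv.Perm (Fin n)

/-- The placement obtained from `σ` by exchanging the contents of the drawers `i` and `j`. -/
def swapDrawers {n : ℕ} (σ : Placement n) (i j : Fin n) : Placement n :=
  (Equiv.swap i j).trans σ

/-- A (deterministic) strategy of the spy and the `n` prisoners.
The spy inspects the whole initial placement and then chooses two drawers, whose contents are
exchanged. Each prisoner opens drawers one after another; the next drawer is chosen on the basis of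
the prisoner's own number and of the list of the numbers this prisoner has seen so far, in the order
in which they were seen. -/
structure SpyStrategy (n : ℕ) where
  /-- The two drawers whose contents the spy swaps, given the initial placement. -/
  spy : Placement n → Fin n × Fin n
  /-- The drawer that a prisoner opens next, given the numbers seen by this prisoner so far. -/
  nextDrawer : Fin n → List (Fin n) → Fin n

/-- The numbers seen, in order, in the first `t` drawers opened under the rule `next`, when the
drawers are filled according to `σ`. -/
def numbersSeen {n : ℕ} (next : List (Fin n) → Fin n) (σ : Placement n) : ℕ → List (Fin n)
  | 0 => []
  | t + 1 => numbersSeen next σ t ++ [σ (next (numbersSeen next σ t))]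

namespace SpyStrategy

/-- The placement the prisoners are faced with: the initial one after the spy's swap. -/
def placementAfter {n : ℕ} (S : SpyStrategy n) (σ : Placement n) : Placement n :=
  swapDrawers σ (S.spy σ).1 (S.spy σ).2

/-- The spy always swaps the contents of two different drawers. -/
def AlwaysSwaps {n : ℕ} (S : SpyStrategy n) : Prop :=
  ∀ σ : Placement n, (S.spy σ).1 ≠ (S.spy σ).2

/-- For every initial placement, after the spy's swap every prisoner finds their own number by
opening at most `k` drawers. -/
def SucceedsWith {n : ℕ} (S : SpyStrategy n) (k : ℕ) : Prop :=
  ∀ (σ : Placement n) (p : Fin n), p ∈ numbersSeen (S.nextDrawer p) (S.placementAfter σ) k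

end SpyStrategy

/-! Lower bound. Once the prisoners' rules are fixed, only a fraction at most `1 / (n / k)!` of all
placements lets everybody succeed (`card_successful_le`). To see this, reveal the placement drawer
by drawer: while `r + 1` drawers are closed, let some prisoner whose number is still unseen search.
Each newly opened drawer shows that number with probability one over the number of closed drawers,
which gives a recursion for the success probability. The swap and the resulting placement determine
the initial one, so at most `n ^ 2` initial placements lead to each successful one. Hence `(n / k)!
≤ n ^ 2`, and Stirling gives the bound.

Existence. All prisoners open the first `m` drawers and use the contents to look up a permutation
`π` in a common table; then each follows the cycle of `σ * π` through the own number. This works if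
all cycles are short, which has some density `ρ` (`factorial_mul_pow_le_card_shortCycles`). The `m *
(n - m)` swaps of one of the first `m` drawers with a later one consult distinct table entries. For
a random table they are therefore independent trials, and all fail with probability at most `(1 - ρ)
^ (m * (n - m))`. A union bound over the `n!` placements yields one table for all of them
(`exists_strategy`). With `m` about `n / log n` and cycle length about `n log log n / log n`, `ρ` is
large enough and `m` is of lower order. -/

/-! ### Revealing a placement drawer by drawer -/

/-- The placements in `X` that agree with `v` on the drawers in `R`. -/
def agreeing {n : ℕ} (X : Finset (Placement n)) (R : Finset (Fin n)) (v : Placement n) :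
    Finset (Placement n) :=
  {τ ∈ X | ∀ x ∈ R, τ x = v x}

theorem mem_agreeing {n : ℕ} {X : Finset (Placement n)} {R : Finset (Fin n)} {v τ : Placement n} :
    τ ∈ agreeing X R v ↔ τ ∈ X ∧ ∀ x ∈ R, τ x = v x := by
  simp [agreeing]

/-- The placement `v` modified so that drawer `d` contains `q`. -/
def putInto {n : ℕ} (v : Placement n) (d q : Fin n) : Placement n :=
  v.trans (Equiv.swap (v d) q)

theorem putInto_self {n : ℕ} (v : Placement n) (d q : Fin n) : putInto v d q d = q := by
  simp [putInto]

theorem putInto_of_mem {n : ℕ} {R : Finset (Fin n)} {v : Placement n} {d q x : Fin n}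
    (hd : d ∉ R) (hq : q ∉ R.image v) (hx : x ∈ R) : putInto v d q x = v x := by
  have h1 : v x ≠ v d := fun h => hd (v.injective h ▸ hx)
  have h2 : v x ≠ q := fun h => hq (h ▸ Finset.mem_image_of_mem v hx)
  simp [putInto, Equiv.swap_apply_of_ne_of_ne h1 h2]

/-- Opening a closed drawer `d` shows some number not seen before. Splitting by that number turns
the counts below into recursions in the number of closed drawers. -/
theorem card_agreeing_eq_sum {n : ℕ} (X : Finset (Placement n)) {R : Finset (Fin n)}
    (v : Placement n) {d : Fin n} (hd : d ∉ R) :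
    (agreeing X R v).card =
      ∑ q ∈ (R.image v)ᶜ, (agreeing X (insert d R) (putInto v d q)).card := by
  rw [Finset.card_eq_sum_card_fiberwise (f := fun τ : Placement n => τ d) (t := (R.image v)ᶜ)]
  · refine Finset.sum_congr rfl fun q hq => ?_
    rw [Finset.mem_compl] at hq
    congr 1
    ext τ
    simp only [Finset.mem_filter, mem_agreeing, Finset.forall_mem_insert, putInto_self]
    constructor
    · rintro ⟨⟨h1, h2⟩, h3⟩
      exact ⟨h1, h3, fun x hx => by rw [h2 x hx, putInto_of_mem hd hq hx]⟩
    · rintro ⟨h1, h3, h2⟩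
      exact ⟨⟨h1, fun x hx => by rw [h2 x hx, putInto_of_mem hd hq hx]⟩, h3⟩
  · intro τ hτ
    rw [Finset.mem_coe, mem_agreeing] at hτ
    simp only [Finset.coe_compl, Set.mem_compl_iff, Finset.mem_coe, Finset.mem_image, not_exists,
      not_and]
    intro x hx h
    rw [← hτ.2 x hx] at h
    exact hd (τ.injective h ▸ hx)

theorem card_compl_image {n : ℕ} (R : Finset (Fin n)) (v : Placement n) :
    (R.image v)ᶜ.card = Rᶜ.card := by
  rw [Finset.card_compl, Finset.card_compl, Finset.card_image_of_injective _ v.injective]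

theorem card_compl_insert {n : ℕ} {R : Finset (Fin n)} {d : Fin n} (hd : d ∉ R) :
    (insert d R)ᶜ.card + 1 = Rᶜ.card := by
  rw [Finset.compl_insert]
  exact Finset.card_erase_add_one (Finset.mem_compl.2 hd)

theorem card_agreeing_univ_le {n : ℕ} (X : Finset (Placement n)) (v : Placement n) :
    (agreeing X Finset.univ v).card ≤ 1 := by
  refine (Finset.card_le_card (t := {v}) fun τ hτ => ?_).trans (by simp)
  rw [mem_agreeing] at hτ
  rw [Finset.mem_singleton]
  ext x
  rw [hτ.2 x (Finset.mem_univ x)]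

theorem card_agreeing_le_factorial {n : ℕ} (X : Finset (Placement n)) (r : ℕ) :
    ∀ (R : Finset (Fin n)) (v : Placement n), Rᶜ.card = r →
      (agreeing X R v).card ≤ r.factorial := by
  induction r with
  | zero =>
    intro R v hR
    obtain rfl : R = Finset.univ := by simpa using hR
    simpa using card_agreeing_univ_le X v
  | succ r ih =>
    intro R v hR
    obtain ⟨d, hd⟩ : Rᶜ.Nonempty := Finset.card_pos.1 (by omega)
    rw [Finset.mem_compl] at hd
    rw [card_agreeing_eq_sum X v hd]
    refine (Finset.sum_le_card_nsmul _ _ r.factorial fun q _ => ih _ _ ?_).trans ?_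
    · have := card_compl_insert hd
      omega
    · rw [card_compl_image, hR, smul_eq_mul, Nat.factorial_succ]

/-! ### Few placements are successful for fixed rules -/

theorem numbersSeen_congr {n : ℕ} {next : List (Fin n) → Fin n} {v w : Placement n} {t : ℕ}
    (h : ∀ i < t, w (next (numbersSeen next v i)) = v (next (numbersSeen next v i))) :
    numbersSeen next w t = numbersSeen next v t := by
  induction t with
  | zero => rfl
  | succ t ih =>
    have := ih fun i hi => h i (by omega)
    rw [numbersSeen, numbersSeen, this, h t (by omega)]

theorem mem_numbersSeen {n : ℕ} {next : List (Fin n) → Fin n} {v : Placement n} {t : ℕ}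
    {p : Fin n} :
    p ∈ numbersSeen next v t ↔ ∃ i < t, v (next (numbersSeen next v i)) = p := by
  induction t with
  | zero => simp [numbersSeen]
  | succ t ih =>
    rw [numbersSeen, List.mem_append, ih, List.mem_singleton]
    constructor
    · rintro (⟨i, hi, h⟩ | h)
      · exact ⟨i, by omega, h⟩
      · exact ⟨t, by omega, h.symm⟩
    · rintro ⟨i, hi, h⟩
      rcases Nat.lt_succ_iff_lt_or_eq.1 hi with hi | rfl
      · exact Or.inl ⟨i, hi, h⟩
      · exact Or.inr h.symm

/-- The placements for which every prisoner finds the own number within `k` drawers. -/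
def successful {n : ℕ} (next : Fin n → List (Fin n) → Fin n) (k : ℕ) : Finset (Placement n) :=
  {τ | ∀ p, p ∈ numbersSeen (next p) τ k}

theorem mem_successful {n : ℕ} {next : Fin n → List (Fin n) → Fin n} {k : ℕ} {τ : Placement n} :
    τ ∈ successful next k ↔ ∀ p, p ∈ numbersSeen (next p) τ k := by
  simp [successful]

/-- A prisoner `p` with `s` openings left, all previously opened drawers being in `R`. -/
theorem card_agreeing_successful_le_of_searching {n : ℕ} (next : Fin n → List (Fin n) → Fin n)
    (k : ℕ) {a : ℕ → ℝ} (ha : ∀ i, 0 ≤ a i) {r₀ : ℕ}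
    (hclean : ∀ (R : Finset (Fin n)) (v : Placement n), Rᶜ.card < r₀ →
      ((agreeing (successful next k) R v).card : ℝ) ≤ (Rᶜ.card).factorial * a Rᶜ.card)
    (p : Fin n) (s : ℕ) :
    ∀ (R : Finset (Fin n)) (v : Placement n) (t r : ℕ), t + s = k → Rᶜ.card = r + 1 → r < r₀ →
      (∀ i < t, next p (numbersSeen (next p) v i) ∈ R) → p ∉ R.image v →
      ((agreeing (successful next k) R v).card : ℝ) ≤
        r.factorial * ∑ j ∈ Finset.range s, a (r - j) := by
  induction s with
  | zero =>
    intro R v t r htk hr hr₀ hopen hp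
    have : agreeing (successful next k) R v = ∅ := by
      refine Finset.eq_empty_of_forall_notMem fun τ hτ => ?_
      rw [mem_agreeing, mem_successful] at hτ
      obtain rfl : t = k := by omega
      have h := hτ.1 p
      rw [numbersSeen_congr fun i hi => hτ.2 _ (hopen i hi), mem_numbersSeen] at h
      obtain ⟨i, hi, h⟩ := h
      exact hp (h ▸ Finset.mem_image_of_mem v (hopen i hi))
    simp [this]
  | succ s ih =>
    intro R v t r htk hr hr₀ hopen hp
    set d := next p (numbersSeen (next p) v t) with hd
    -- Reopening a drawer reveals nothing and only wastes an opening; since `a` is nonnegative, the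
    -- bound for `s` openings is below that for `s + 1`.
    by_cases hdR : d ∈ R
    · refine (ih R v (t + 1) r (by omega) hr hr₀ (fun i hi => ?_) hp).trans ?_
      · rcases Nat.lt_succ_iff_lt_or_eq.1 hi with hi | rfl
        · exact hopen i hi
        · exact hdR
      · rw [Finset.sum_range_succ]
        have := ha (r - s)
        gcongr
        linarith
    · have hcard : (insert d R)ᶜ.card = r := by
        have := card_compl_insert hdR
        omega
      have hpc : p ∈ (R.image v)ᶜ := Finset.mem_compl.2 hp
      -- The outcome `p` ends the search and gives the term `j = 0`. The other `r` outcomes continue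
      -- the search with one closed drawer fewer, and the factor `r` turns `(r - 1)!` into `r!`.
      rw [card_agreeing_eq_sum _ v hdR, Nat.cast_sum, ← Finset.add_sum_erase _ _ hpc]
      have h1 := hclean (insert d R) (putInto v d p) (by omega)
      have h2 : ∑ q ∈ ((R.image v)ᶜ).erase p,
          ((agreeing (successful next k) (insert d R) (putInto v d q)).card : ℝ) ≤
          r.factorial * ∑ j ∈ Finset.range s, a (r - (j + 1)) := by
        have hc : (((R.image v)ᶜ).erase p).card = r := by
          rw [Finset.card_erase_of_mem hpc, card_compl_image]
          omega
        rcases r with _ | r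
        · rw [Finset.card_eq_zero.1 hc]
          simpa using mul_nonneg (Nat.cast_nonneg s) (ha 0)
        · refine (Finset.sum_le_card_nsmul _ _
            (r.factorial * ∑ j ∈ Finset.range s, a (r - j)) fun q hq => ?_).trans ?_
          · rw [Finset.mem_erase, Finset.mem_compl] at hq
            have hv : ∀ i ≤ t, numbersSeen (next p) (putInto v d q) i = numbersSeen (next p) v i :=
              fun i hi => numbersSeen_congr fun j hj =>
                putInto_of_mem hdR hq.2 (hopen j (by omega))
            refine ih (insert d R) (putInto v d q) (t + 1) r (by omega) hcard (by omega)
              (fun i hi => ?_) ?_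
            · rw [hv i (by omega)]
              rcases Nat.lt_succ_iff_lt_or_eq.1 hi with hi | rfl
              · exact Finset.mem_insert_of_mem (hopen i hi)
              · exact Finset.mem_insert_self _ _
            · rw [Finset.image_insert, Finset.mem_insert, putInto_self]
              rintro (h | h)
              · exact hq.1 h.symm
              · obtain ⟨x, hx, h⟩ := Finset.mem_image.1 h
                rw [putInto_of_mem hdR hq.2 hx] at h
                exact hp (h ▸ Finset.mem_image_of_mem v hx)
          · rw [hc, nsmul_eq_mul, Nat.factorial_succ, Nat.cast_mul, mul_assoc]
            simp only [Nat.add_sub_add_right]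
            exact le_rfl
      rw [hcard] at h1
      rw [Finset.sum_range_succ', mul_add, add_comm]
      exact add_le_add h2 h1

/-- The function `1 / (r / k)!` is a supersolution of the recursion `(r + 1) a (r + 1) = ∑ j < k, a
(r - j)` that the searching prisoners impose. -/
theorem card_successful_le {n : ℕ} (next : Fin n → List (Fin n) → Fin n) {k : ℕ} (hk : 0 < k) :
    ((successful next k).card : ℝ) ≤ n.factorial / (n / k).factorial := by
  have key : ∀ r : ℕ, ∀ (R : Finset (Fin n)) (v : Placement n), Rᶜ.card = r →
      ((agreeing (successful next k) R v).card : ℝ) ≤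
        r.factorial * (1 / (r / k).factorial) := by
    intro r
    induction r using Nat.strong_induction_on with
    | _ r ih =>
      intro R v hR
      rcases lt_or_ge r k with hrk | hrk
      · rw [Nat.div_eq_of_lt hrk]
        simpa using card_agreeing_le_factorial (successful next k) r R v hR
      · obtain ⟨r, rfl⟩ : ∃ r', r = r' + 1 := ⟨r - 1, by omega⟩
        obtain ⟨p, hp⟩ : ((R.image v)ᶜ).Nonempty :=
          Finset.card_pos.1 (by rw [card_compl_image]; omega)
        rw [Finset.mem_compl] at hp
        refine (card_agreeing_successful_le_of_searching next k
          (a := fun i => 1 / ((i / k).factorial : ℝ)) (fun i => by positivity) (r₀ := r + 1)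
          (fun R v h => ih _ h R v rfl) p k R v 0 r (by omega) hR (by omega)
          (fun i hi => by omega) hp).trans ?_
        -- For `j < k` one has `r - j ≥ r + 1 - k`, so each of the `k` terms is at most `1 / q!`. As
        -- `q + 1 = (r + 1) / k`, the claim reduces to `(q + 1) * k ≤ r + 1`.
        set q := (r + 1 - k) / k with hq
        have hq1 : (r + 1) / k = q + 1 := by
          rw [hq, ← Nat.add_div_right _ hk, Nat.sub_add_cancel hrk]
        have hqr : ((q : ℝ) + 1) * k ≤ r + 1 := by
          exact_mod_cast hq1 ▸ Nat.div_mul_le_self (r + 1) k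
        have hsum : ∑ j ∈ Finset.range k, 1 / (((r - j) / k).factorial : ℝ) ≤
            k * (1 / (q.factorial : ℝ)) := by
          refine (Finset.sum_le_card_nsmul _ _ (1 / (q.factorial : ℝ)) fun j hj => ?_).trans ?_
          · rw [Finset.mem_range] at hj
            have : q ≤ (r - j) / k := Nat.div_le_div_right (by omega)
            gcongr
          · simp
        refine (mul_le_mul_of_nonneg_left hsum (by positivity)).trans ?_
        rw [hq1, Nat.factorial_succ, Nat.factorial_succ]
        push_cast
        rw [mul_one_div, mul_one_div, ← mul_div_assoc,
          div_le_div_iff₀ (by positivity) (by positivity)]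
        have : (0 : ℝ) ≤ r.factorial * q.factorial := by positivity
        nlinarith
  have h := key n ∅ (Equiv.refl _) (by simp)
  have h2 : agreeing (successful next k) ∅ (Equiv.refl _) = successful next k := by
    simp [agreeing]
  rwa [h2, mul_one_div] at h

/-- Undoing the swap recovers the initial placement, so `n! ≤ n ^ 2 * #successful`. -/
theorem SpyStrategy.factorial_le_of_succeedsWith {n k : ℕ} {S : SpyStrategy n}
    (h : S.SucceedsWith k) (hk : 0 < k) : (n / k).factorial ≤ n ^ 2 := by
  have hinj : Function.Injective fun σ : Placement n => (S.spy σ, S.placementAfter σ) := by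
    intro σ σ' hσ
    simp only [Prod.mk.injEq, placementAfter, swapDrawers] at hσ
    rw [hσ.1] at hσ
    ext x
    have := DFunLike.congr_fun hσ.2 (Equiv.swap (S.spy σ').1 (S.spy σ').2 x)
    simp only [Equiv.trans_apply, Equiv.swap_apply_self] at this
    rw [this]
  have h1 : (Finset.univ : Finset (Placement n)).card ≤
      ((Finset.univ : Finset (Fin n × Fin n)) ×ˢ successful S.nextDrawer k).card :=
    Finset.card_le_card_of_injOn _
      (fun σ _ => by simpa [mem_successful] using h σ) hinj.injOn
  rw [Finset.card_product, Finset.card_univ, Fintype.card_perm, Finset.card_univ,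
    Fintype.card_prod, Fintype.card_fin] at h1
  have h2 := card_successful_le S.nextDrawer hk
  have h3 : (n.factorial : ℝ) ≤ n * n * (n.factorial / (n / k).factorial) :=
    (by exact_mod_cast h1 : (n.factorial : ℝ) ≤ n * n * (successful S.nextDrawer k).card).trans
      (by gcongr)
  have h4 : (0 : ℝ) < n.factorial := by positivity
  have h5 : (0 : ℝ) < (n / k).factorial := by positivity
  rw [← mul_div_assoc, le_div_iff₀ h5, mul_comm] at h3
  have h6 := le_of_mul_le_mul_right h3 h4
  rw [pow_two]
  exact_mod_cast h6

/-! ### Permutations with short cycles only -/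

open Classical in
/-- The permutations all of whose cycles have length at most `k`. -/
noncomputable def shortCycles (n k : ℕ) : Finset (Placement n) :=
  {τ | ∀ p, ∃ j, 1 ≤ j ∧ j ≤ k ∧ τ^[j] p = p}

theorem mem_shortCycles {n k : ℕ} {τ : Placement n} :
    τ ∈ shortCycles n k ↔ ∀ p, ∃ j, 1 ≤ j ∧ j ≤ k ∧ τ^[j] p = p := by
  simp [shortCycles]

/-- The set `R` is a union of cycles of `v` of length at most `k`. -/
def IsUnionOfShortCycles {n : ℕ} (k : ℕ) (R : Finset (Fin n)) (v : Placement n) : Prop :=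
  (∀ x ∈ R, v x ∈ R) ∧ ∀ x ∈ R, ∃ j, 1 ≤ j ∧ j ≤ k ∧ v^[j] x = x

theorem iterate_eq_of_eqOn {n : ℕ} {R : Finset (Fin n)} {v w : Placement n}
    (hR : ∀ x ∈ R, v x ∈ R) (h : ∀ x ∈ R, w x = v x) {x : Fin n} (hx : x ∈ R) (j : ℕ) :
    w^[j] x = v^[j] x ∧ v^[j] x ∈ R := by
  induction j with
  | zero => exact ⟨rfl, hx⟩
  | succ j ih =>
    rw [Function.iterate_succ_apply', Function.iterate_succ_apply', ih.1, h _ ih.2]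
    exact ⟨rfl, hR _ ih.2⟩

theorem IsUnionOfShortCycles.congr {n k : ℕ} {R : Finset (Fin n)} {v w : Placement n}
    (hR : IsUnionOfShortCycles k R v) (h : ∀ x ∈ R, w x = v x) : IsUnionOfShortCycles k R w := by
  refine ⟨fun x hx => h x hx ▸ hR.1 x hx, fun x hx => ?_⟩
  obtain ⟨j, h1, h2, h3⟩ := hR.2 x hx
  exact ⟨j, h1, h2, by rw [(iterate_eq_of_eqOn hR.1 h hx j).1, h3]⟩

theorem IsUnionOfShortCycles.image_eq {n k : ℕ} {R : Finset (Fin n)} {v : Placement n}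
    (hR : IsUnionOfShortCycles k R v) : R.image v = R :=
  Finset.eq_of_subset_of_card_le (Finset.image_subset_iff.2 hR.1)
    (Finset.card_image_of_injective _ v.injective).ge

/-- The drawers in `R₀` together with the first `t` drawers on the cycle of `v` from `p`. -/
def withOrbit {n : ℕ} (R₀ : Finset (Fin n)) (v : Placement n) (p : Fin n) (t : ℕ) :
    Finset (Fin n) :=
  R₀ ∪ (Finset.range t).image fun i => v^[i] p

theorem mem_withOrbit {n : ℕ} {R₀ : Finset (Fin n)} {v : Placement n} {p x : Fin n} {t : ℕ} :
    x ∈ withOrbit R₀ v p t ↔ x ∈ R₀ ∨ ∃ i < t, v^[i] p = x := by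
  simp [withOrbit]

/-- The counterpart of the searching bound, from below: the cycle of `p` is revealed step by step.
Putting `p` into the end `v^[t] p` of the path closes a cycle of length `t + 1 ≤ k`; any other
number prolongs the path. The condition `s ≤ r + 1` keeps `r - j` from being truncated. -/
theorem le_card_agreeing_shortCycles_of_orbit {n k : ℕ} {a : ℕ → ℝ} {r₀ : ℕ}
    (hclean : ∀ (R : Finset (Fin n)) (v : Placement n), Rᶜ.card < r₀ →
      IsUnionOfShortCycles k R v →
      (Rᶜ.card).factorial * a Rᶜ.card ≤ ((agreeing (shortCycles n k) R v).card : ℝ))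
    (R₀ : Finset (Fin n)) (p : Fin n) (s : ℕ) :
    ∀ (v : Placement n) (t r : ℕ), t + s ≤ k → (withOrbit R₀ v p t)ᶜ.card = r + 1 → r < r₀ →
      s ≤ r + 1 → IsUnionOfShortCycles k R₀ v → (∀ i ≤ t, v^[i] p ∉ R₀) →
      (∀ i < t, v^[i + 1] p ≠ p) →
      r.factorial * ∑ j ∈ Finset.range s, a (r - j) ≤
        ((agreeing (shortCycles n k) (withOrbit R₀ v p t) v).card : ℝ) := by
  induction s with
  | zero =>
    intros
    simp
  | succ s ih =>
    intro v t r htk hr hr₀ hsr hR₀ horb hne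
    set R := withOrbit R₀ v p t with hR
    set d := v^[t] p with hd
    have hdR : d ∉ R := by
      rw [hR, mem_withOrbit]
      rintro (h | ⟨i, hi, h⟩)
      · exact horb t le_rfl h
      · obtain ⟨j, rfl⟩ : ∃ j, t = i + (j + 1) := ⟨t - i - 1, by omega⟩
        rw [hd, Function.iterate_add_apply] at h
        exact hne j (by omega) (v.injective.iterate i h).symm
    have hp : p ∉ R.image v := by
      rw [Finset.mem_image]
      rintro ⟨x, hx, h⟩
      rcases mem_withOrbit.1 hx with hx | ⟨i, hi, rfl⟩
      · exact horb 0 (by omega) (h ▸ hR₀.1 x hx)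
      · exact hne i hi (by rw [Function.iterate_succ_apply', h])
    have hcard : (insert d R)ᶜ.card = r := by
      have := card_compl_insert hdR
      omega
    have hsub : ∀ x ∈ R₀, x ∈ R := fun x hx => mem_withOrbit.2 (Or.inl hx)
    -- the modified placement keeps the cycles in `R₀` and the orbit of `p` up to `d`
    have hmod : ∀ q ∉ R.image v, IsUnionOfShortCycles k R₀ (putInto v d q) ∧
        (∀ i ≤ t, (putInto v d q)^[i] p = v^[i] p) ∧ (putInto v d q)^[t + 1] p = q ∧
        insert d R = withOrbit R₀ (putInto v d q) p (t + 1) := by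
      intro q hq
      have h1 : ∀ i ≤ t, (putInto v d q)^[i] p = v^[i] p := by
        intro i
        induction i with
        | zero => exact fun _ => rfl
        | succ i ih' =>
          intro hi
          rw [Function.iterate_succ_apply', Function.iterate_succ_apply', ih' (by omega)]
          exact putInto_of_mem hdR hq (mem_withOrbit.2 (Or.inr ⟨i, by omega, rfl⟩))
      refine ⟨hR₀.congr fun x hx => putInto_of_mem hdR hq (hsub x hx), h1, ?_, ?_⟩
      · rw [Function.iterate_succ_apply', h1 t le_rfl, ← hd, putInto_self]
      · ext x
        rw [Finset.mem_insert, mem_withOrbit, mem_withOrbit]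
        constructor
        · rintro (rfl | h | ⟨i, hi, rfl⟩)
          · exact Or.inr ⟨t, by omega, h1 t le_rfl⟩
          · exact Or.inl h
          · exact Or.inr ⟨i, by omega, h1 i (by omega)⟩
        · rintro (h | ⟨i, hi, rfl⟩)
          · exact Or.inr (Or.inl h)
          · rw [h1 i (by omega)]
            rcases Nat.lt_succ_iff_lt_or_eq.1 hi with hi | rfl
            · exact Or.inr (Or.inr ⟨i, hi, rfl⟩)
            · exact Or.inl rfl
    have hpc : p ∈ (R.image v)ᶜ := Finset.mem_compl.2 hp
    rw [card_agreeing_eq_sum _ v hdR, Nat.cast_sum, ← Finset.add_sum_erase _ _ hpc]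
    have h1 : r.factorial * a r ≤
        ((agreeing (shortCycles n k) (insert d R) (putInto v d p)).card : ℝ) := by
      obtain ⟨m1, m2, m3, m4⟩ := hmod p hp
      have := hclean (insert d R) (putInto v d p) (by omega) ?_
      · rwa [hcard] at this
      · rw [m4]
        constructor
        · intro x hx
          rcases mem_withOrbit.1 hx with hx | ⟨i, hi, rfl⟩
          · exact mem_withOrbit.2 (Or.inl (m1.1 x hx))
          · rw [← Function.iterate_succ_apply' (putInto v d p), mem_withOrbit]
            rcases Nat.lt_succ_iff_lt_or_eq.1 hi with hi | rfl
            · exact Or.inr ⟨i + 1, by omega, rfl⟩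
            · exact Or.inr ⟨0, by omega, by rw [m3]; rfl⟩
        · intro x hx
          rcases mem_withOrbit.1 hx with hx | ⟨i, hi, rfl⟩
          · exact m1.2 x hx
          · exact ⟨t + 1, by omega, by omega, by
              rw [← Function.iterate_add_apply, add_comm, Function.iterate_add_apply, m3]⟩
    have h2 : r.factorial * ∑ j ∈ Finset.range s, a (r - (j + 1)) ≤
        ∑ q ∈ ((R.image v)ᶜ).erase p,
          ((agreeing (shortCycles n k) (insert d R) (putInto v d q)).card : ℝ) := by
      have hc : (((R.image v)ᶜ).erase p).card = r := by
        rw [Finset.card_erase_of_mem hpc, card_compl_image]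
        omega
      rcases r with _ | r
      · obtain rfl : s = 0 := by omega
        rw [Finset.card_eq_zero.1 hc]
        simp
      · refine le_trans ?_ (Finset.card_nsmul_le_sum _ _
          (r.factorial * ∑ j ∈ Finset.range s, a (r - j)) fun q hq => ?_)
        · rw [hc, nsmul_eq_mul, Nat.factorial_succ, Nat.cast_mul, mul_assoc]
          simp only [Nat.add_sub_add_right]
          exact le_rfl
        · rw [Finset.mem_erase, Finset.mem_compl] at hq
          obtain ⟨m1, m2, m3, m4⟩ := hmod q hq.2
          rw [m4] at hcard ⊢
          refine ih (putInto v d q) (t + 1) r (by omega) hcard (by omega) (by omega) m1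
            (fun i hi => ?_) (fun i hi => ?_)
          · rcases Nat.le_succ_iff.1 hi with hi | rfl
            · rw [m2 i hi]
              exact horb i hi
            · rw [m3]
              intro hq0
              rw [← hR₀.image_eq] at hq0
              obtain ⟨x, hx, h⟩ := Finset.mem_image.1 hq0
              exact hq.2 (h ▸ Finset.mem_image_of_mem v (hsub x hx))
          · rcases Nat.lt_succ_iff_lt_or_eq.1 hi with hi | rfl
            · rw [m2 (i + 1) (by omega)]
              exact hne i hi
            · rw [m3]
              exact hq.1
    rw [Finset.sum_range_succ', mul_add, add_comm]
    exact add_le_add h1 h2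

/-- A lower bound for the number of permutations with short cycles, from any subsolution of the
recursion for their density. -/
theorem le_card_shortCycles {n k : ℕ} {a : ℕ → ℝ} (ha0 : a 0 ≤ 1)
    (ha : ∀ r < n, (r + 1 : ℕ) * a (r + 1) ≤ ∑ j ∈ Finset.range (min k (r + 1)), a (r - j)) :
    n.factorial * a n ≤ ((shortCycles n k).card : ℝ) := by
  have key : ∀ r : ℕ, ∀ (R : Finset (Fin n)) (v : Placement n), Rᶜ.card = r →
      IsUnionOfShortCycles k R v →
      r.factorial * a r ≤ ((agreeing (shortCycles n k) R v).card : ℝ) := by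
    intro r
    induction r using Nat.strong_induction_on with
    | _ r ih =>
      intro R v hR hRv
      rcases r with _ | r
      · obtain rfl : R = Finset.univ := by simpa using hR
        have hv : v ∈ agreeing (shortCycles n k) Finset.univ v :=
          mem_agreeing.2 ⟨mem_shortCycles.2 fun p => hRv.2 p (Finset.mem_univ p), fun _ _ => rfl⟩
        have : (1 : ℝ) ≤ (agreeing (shortCycles n k) Finset.univ v).card := by
          exact_mod_cast Finset.card_pos.2 ⟨v, hv⟩
        simpa using ha0.trans this
      · obtain ⟨p, hp⟩ : Rᶜ.Nonempty := Finset.card_pos.1 (by omega)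
        rw [Finset.mem_compl] at hp
        have hw : withOrbit R v p 0 = R := by simp [withOrbit]
        have hrn : r < n := by
          have : Rᶜ.card ≤ n := by simpa using Finset.card_le_univ Rᶜ
          omega
        have h := le_card_agreeing_shortCycles_of_orbit (a := a) (r₀ := r + 1)
          (fun R v h hv => ih _ h R v rfl hv) R p (min k (r + 1)) v 0 r (by omega)
          (by rw [hw, hR]) (by omega) (by omega) hRv
          (fun i hi => by
            obtain rfl : i = 0 := by omega
            exact hp) (fun i hi => by omega)
        rw [hw] at h
        refine le_trans ?_ h
        rw [Nat.factorial_succ, Nat.cast_mul, mul_comm ((r + 1 : ℕ) : ℝ), mul_assoc]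
        gcongr
        exact ha r hrn
  have h := key n ∅ (Equiv.refl _) (by simp) ⟨by simp, by simp⟩
  have h2 : agreeing (shortCycles n k) ∅ (Equiv.refl _) = shortCycles n k := by
    simp [agreeing]
  rwa [h2] at h

/-- With `c = l / n`, the function `c ^ (r / h)` is a subsolution for cycle length `h + l`: the `l`
terms with `h ≤ j < h + l` alone contribute at least `l * c ^ ((r + 1) / h - 1)`, and `l = n * c ≥
(r + 1) * c`. -/
theorem factorial_mul_pow_le_card_shortCycles {n h l : ℕ} (hh : 0 < h) (hl : 0 < l) (hln : l ≤ n) :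
    n.factorial * ((l : ℝ) / n) ^ (n / h) ≤ ((shortCycles n (h + l)).card : ℝ) := by
  have hn : (0 : ℝ) < n := by exact_mod_cast hl.trans_le hln
  set c : ℝ := (l : ℝ) / n with hc
  have hc0 : 0 < c := by positivity
  have hc1 : c ≤ 1 := div_le_one_of_le₀ (by exact_mod_cast hln) hn.le
  refine le_card_shortCycles (a := fun r => c ^ (r / h)) (by simp) fun r hr => ?_
  have hanti : ∀ i j : ℕ, i ≤ j → c ^ (j / h) ≤ c ^ (i / h) := fun i j hij =>
    pow_le_pow_of_le_one hc0.le hc1 (Nat.div_le_div_right hij)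
  rcases le_total (r + 1) (h + l) with hrk | hrk
  · rw [min_eq_right hrk]
    refine le_trans ?_ (Finset.card_nsmul_le_sum _ _ (c ^ ((r + 1) / h)) fun j hj =>
      hanti _ _ (by omega))
    simp
  · rw [min_eq_left hrk, Finset.sum_range_add]
    have hpos : 0 ≤ ∑ j ∈ Finset.range h, c ^ ((r - j) / h) :=
      Finset.sum_nonneg fun j _ => by positivity
    have hq : (r + 1) / h = (r + 1 - h) / h + 1 := by
      rw [← Nat.add_div_right _ hh, Nat.sub_add_cancel (by omega)]
    have hsum : (l : ℝ) * c ^ ((r + 1 - h) / h) ≤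
        ∑ j ∈ Finset.range l, c ^ ((r - (h + j)) / h) := by
      refine le_trans ?_ (Finset.card_nsmul_le_sum _ _ (c ^ ((r + 1 - h) / h)) fun j hj =>
        hanti _ _ (by omega))
      simp
    have hrc : ((r + 1 : ℕ) : ℝ) * c ≤ l := by
      rw [hc, ← mul_div_assoc, div_le_iff₀ hn, mul_comm]
      gcongr
      exact_mod_cast hr
    have : ((r + 1 : ℕ) : ℝ) * c ^ ((r + 1) / h) ≤ l * c ^ ((r + 1 - h) / h) := by
      rw [hq, pow_succ, mul_comm (c ^ _) c, ← mul_assoc]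
      gcongr
    linarith

/-! ### Following cycles with the help of a table -/

theorem length_numbersSeen {n : ℕ} (next : List (Fin n) → Fin n) (σ : Placement n) (t : ℕ) :
    (numbersSeen next σ t).length = t := by
  induction t with
  | zero => rfl
  | succ t ih => simp [numbersSeen, ih]

theorem getD_numbersSeen {n : ℕ} (next : List (Fin n) → Fin n) (σ : Placement n) (p : Fin n)
    {t i : ℕ} (hi : i < t) :
    (numbersSeen next σ t).getD i p = σ (next (numbersSeen next σ i)) := by
  induction t with
  | zero => omega
  | succ t ih =>
    rw [numbersSeen]
    rcases Nat.lt_succ_iff_lt_or_eq.1 hi with hi | rfl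
    · rw [List.getD_append _ _ _ _ (by rwa [length_numbersSeen]), ih hi]
    · rw [List.getD_append_right _ _ _ _ (by rw [length_numbersSeen]), length_numbersSeen]
      simp

theorem getLastD_numbersSeen_succ {n : ℕ} (next : List (Fin n) → Fin n) (σ : Placement n)
    (p : Fin n) (t : ℕ) :
    (numbersSeen next σ (t + 1)).getLastD p = σ (next (numbersSeen next σ t)) := by
  simp [numbersSeen]

theorem numbersSeen_subset {n : ℕ} (next : List (Fin n) → Fin n) (σ : Placement n) {s t : ℕ}
    (hst : s ≤ t) {p : Fin n} (hp : p ∈ numbersSeen next σ s) : p ∈ numbersSeen next σ t := by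
  rw [mem_numbersSeen] at hp ⊢
  obtain ⟨i, hi, h⟩ := hp
  exact ⟨i, hi.trans_le hst, h⟩

theorem SpyStrategy.SucceedsWith.mono {n k l : ℕ} {S : SpyStrategy n} (h : S.SucceedsWith k)
    (hkl : k ≤ l) : S.SucceedsWith l :=
  fun σ p => numbersSeen_subset _ _ hkl (h σ p)

/-- Open the first `m` drawers; then use their contents to look up a permutation `π` in a table and
follow the cycle of `σ * π` through the own number. -/
def tableNext {n m : ℕ} (hm : m ≤ n) (table : (Fin m → Fin n) → Placement n) (p : Fin n)
    (l : List (Fin n)) : Fin n :=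
  if h : l.length < m then Fin.castLE hm ⟨l.length, h⟩
  -- Here at least `m` numbers have been seen, and more than `m` when the last one is used, so the
  -- defaults `p` never matter.
  else table (fun i => l.getD i p) (if l.length = m then p else l.getLastD p)

/-- Opening drawer `π x` shows `σ (π x)`, so every opening after the first `m` is one step along the
cycle of `σ * π`. -/
theorem apply_tableNext {n m : ℕ} (hm : m ≤ n) (table : (Fin m → Fin n) → Placement n)
    (p : Fin n) (σ : Placement n) (j : ℕ) :
    σ (tableNext hm table p (numbersSeen (tableNext hm table p) σ (m + j))) =
      (σ * table fun i => σ (Fin.castLE hm i))^[j + 1] p := by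
  have htab : ∀ j, (fun i : Fin m =>
      (numbersSeen (tableNext hm table p) σ (m + j)).getD i p) =
      fun i => σ (Fin.castLE hm i) := by
    intro j
    funext i
    rw [getD_numbersSeen _ _ _ (by omega : (i : ℕ) < m + j)]
    congr 1
    simp [tableNext, length_numbersSeen]
  induction j with
  | zero =>
    conv_lhs => rw [tableNext]
    rw [dif_neg (by rw [length_numbersSeen]; omega), htab,
      if_pos (by rw [length_numbersSeen]; rfl)]
    rfl
  | succ j ih =>
    conv_lhs => rw [tableNext]
    rw [dif_neg (by rw [length_numbersSeen]; omega), htab,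
      if_neg (by rw [length_numbersSeen]; omega), ← add_assoc, getLastD_numbersSeen_succ, ih,
      Function.iterate_succ_apply' _ (j + 1)]
    rfl

theorem mem_numbersSeen_tableNext {n m k : ℕ} (hm : m ≤ n) (table : (Fin m → Fin n) → Placement n)
    {σ : Placement n} (h : (σ * table fun i => σ (Fin.castLE hm i)) ∈ shortCycles n k)
    (p : Fin n) : p ∈ numbersSeen (tableNext hm table p) σ (m + k) := by
  obtain ⟨j, hj1, hjk, hj⟩ := mem_shortCycles.1 h p
  rw [mem_numbersSeen]
  refine ⟨m + (j - 1), by omega, ?_⟩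
  rw [apply_tableNext, Nat.sub_add_cancel hj1, hj]

/-! ### Random tables and the union bound -/

/-- A uniformly random `f` takes independent values at the distinct points `e i`, so all constraints
hold with probability at most `(b / #P) ^ #ι`; denominators are cleared. -/
theorem card_tables_le {ι T P : Type*} [Fintype ι] [Fintype T] [DecidableEq T] [Fintype P]
    [DecidableEq P] {e : ι → T} (he : Function.Injective e) (A : ι → Finset P) {b : ℕ}
    (hA : ∀ i, (A i).card ≤ b) :
    (Finset.univ.filter fun f : T → P => ∀ i, f (e i) ∈ A i).card *
        Fintype.card P ^ Fintype.card ι ≤ b ^ Fintype.card ι * Fintype.card (T → P) := by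
  classical
  set s : T → Finset P := fun c => if h : ∃ i, e i = c then A h.choose else Finset.univ with hs
  have hse : ∀ i, s (e i) = A i := by
    intro i
    have h : ∃ j, e j = e i := ⟨i, rfl⟩
    rw [hs]
    simp only [h, dif_pos]
    rw [he h.choose_spec]
  have hcard : (Finset.univ.image e).card = Fintype.card ι := by
    rw [Finset.card_image_of_injective _ he, Finset.card_univ]
  have hsub : (Finset.univ.filter fun f : T → P => ∀ i, f (e i) ∈ A i) ⊆ Fintype.piFinset s := by
    intro f hf
    rw [Finset.mem_filter] at hf
    rw [Fintype.mem_piFinset]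
    intro c
    by_cases h : ∃ i, e i = c
    · obtain ⟨i, rfl⟩ := h
      rw [hse]
      exact hf.2 i
    · simp [hs, h]
  have h1 : ∏ c ∈ Finset.univ.image e, (s c).card ≤ b ^ Fintype.card ι := by
    rw [← hcard]
    refine Finset.prod_le_pow_card _ _ _ fun c hc => ?_
    obtain ⟨i, -, rfl⟩ := Finset.mem_image.1 hc
    rw [hse]
    exact hA i
  have h2 : ∏ c ∈ (Finset.univ.image e)ᶜ, (s c).card ≤
      Fintype.card P ^ ((Finset.univ.image e)ᶜ).card :=
    Finset.prod_le_pow_card _ _ _ fun c _ => Finset.card_le_univ _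
  calc _ ≤ (∏ c, (s c).card) * Fintype.card P ^ Fintype.card ι := by
        gcongr
        rw [← Fintype.card_piFinset]
        exact Finset.card_le_card hsub
    _ ≤ (b ^ Fintype.card ι * Fintype.card P ^ ((Finset.univ.image e)ᶜ).card) *
          Fintype.card P ^ Fintype.card ι := by
        rw [← Finset.prod_mul_prod_compl (Finset.univ.image e)]
        gcongr
    _ = _ := by
        rw [mul_assoc, ← pow_add, Fintype.card_fun, ← hcard, add_comm, Finset.card_add_card_compl]

/-- The first drawer of a swap is among the first `m`, the second is not. -/
abbrev CrossSwap (n m : ℕ) : Type := Fin m × {j : Fin n // m ≤ (j : ℕ)}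

theorem card_crossSwap {n m : ℕ} (hm : m ≤ n) : Fintype.card (CrossSwap n m) = m * (n - m) := by
  have h := Fintype.card_subtype_compl fun j : Fin n => (j : ℕ) < m
  have h2 : Fintype.card {j : Fin n // (j : ℕ) < m} = m := by
    rw [Fintype.card_congr (Fin.castLEquiv hm).symm]
    simp
  simp only [not_lt] at h
  rw [Fintype.card_prod, Fintype.card_fin, h, h2, Fintype.card_fin]

/-- The contents of the first `m` drawers after the given swap. -/
def contentsAfter {n m : ℕ} (hm : m ≤ n) (σ : Placement n) (e : CrossSwap n m) : Fin m → Fin n :=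
  fun a => swapDrawers σ (Fin.castLE hm e.1) e.2 (Fin.castLE hm a)

/-- This makes the trials independent. Among the first `m` drawers exactly one changes its content,
which identifies it, and the new content identifies the other drawer. -/
theorem contentsAfter_injective {n m : ℕ} (hm : m ≤ n) (σ : Placement n) :
    Function.Injective (contentsAfter hm σ) := by
  have hne : ∀ (a : Fin m) (j : {j : Fin n // m ≤ (j : ℕ)}), Fin.castLE hm a ≠ j := by
    intro a j h
    have h1 := congrArg Fin.val h
    have h2 := a.2
    have h3 := j.2
    simp only [Fin.val_castLE] at h1
    omega
  rintro ⟨i, j⟩ ⟨i', j'⟩ h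
  have h1 := congrFun h i
  simp only [contentsAfter, swapDrawers, Equiv.trans_apply, Equiv.swap_apply_left,
    EmbeddingLike.apply_eq_iff_eq] at h1
  by_cases hi : i = i'
  · subst hi
    rw [Equiv.swap_apply_left] at h1
    rw [Subtype.ext h1]
  · rw [Equiv.swap_apply_of_ne_of_ne
      (fun h => hi (Fin.castLE_injective hm h)) (hne i j')] at h1
    exact absurd h1.symm (hne i j)

/-- Multiplication by a fixed placement is injective, so each swap meets a bad table entry with
probability at most the density of the complement of `shortCycles n k`. The hypothesis says that the
expected number of placements for which all cross swaps fail is below one. -/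
theorem exists_strategy {n m k : ℕ} (hm : m ≤ n)
    (hcount : n.factorial * (n.factorial - (shortCycles n k).card) ^ (m * (n - m)) <
      n.factorial ^ (m * (n - m))) :
    ∃ S : SpyStrategy n, S.AlwaysSwaps ∧ S.SucceedsWith (m + k) := by
  classical
  set T := (Fin m → Fin n) → Placement n
  let after : Placement n → CrossSwap n m → Placement n :=
    fun σ e => swapDrawers σ (Fin.castLE hm e.1) e.2
  have hexists : ∃ table : T, ∀ σ, ∃ e : CrossSwap n m,
      after σ e * table (contentsAfter hm σ e) ∈ shortCycles n k := by
    by_contra! hcon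
    set bad : Placement n → Finset T := fun σ => Finset.univ.filter fun table : T =>
      ∀ e, table (contentsAfter hm σ e) ∈ Finset.univ.filter fun π : Placement n =>
        after σ e * π ∉ shortCycles n k with hbad
    have hcover : (Finset.univ : Finset T) ⊆ Finset.univ.biUnion bad := by
      intro table _
      obtain ⟨σ, hσ⟩ := hcon table
      exact Finset.mem_biUnion.2 ⟨σ, Finset.mem_univ _, by simpa [hbad] using hσ⟩
    have hA : ∀ σ e, (Finset.univ.filter fun π : Placement n =>
        after σ e * π ∉ shortCycles n k).card ≤ n.factorial - (shortCycles n k).card := by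
      intro σ e
      have : (Finset.univ.filter fun π : Placement n => after σ e * π ∉ shortCycles n k).card ≤
          ((shortCycles n k)ᶜ).card :=
        Finset.card_le_card_of_injOn (fun π => after σ e * π)
          (fun π hπ => by simpa using hπ) (mul_right_injective _).injOn
      rwa [Finset.card_compl, Fintype.card_perm, Fintype.card_fin] at this
    have hsize : ∀ σ, (bad σ).card * n.factorial ^ (m * (n - m)) ≤
        (n.factorial - (shortCycles n k).card) ^ (m * (n - m)) * Fintype.card T := by
      intro σ
      have := card_tables_le (contentsAfter_injective hm σ) _ (hA σ)
      rwa [card_crossSwap hm, Fintype.card_perm, Fintype.card_fin] at this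
    have h1 : Fintype.card T ≤ ∑ σ, (bad σ).card := by
      rw [← Finset.card_univ]
      exact (Finset.card_le_card hcover).trans Finset.card_biUnion_le
    have h2 : Fintype.card T * n.factorial ^ (m * (n - m)) ≤
        Fintype.card T * (n.factorial * (n.factorial - (shortCycles n k).card) ^ (m * (n - m))) :=
      calc _ ≤ (∑ σ, (bad σ).card) * n.factorial ^ (m * (n - m)) := by gcongr
        _ = ∑ σ, (bad σ).card * n.factorial ^ (m * (n - m)) := Finset.sum_mul _ _ _
        _ ≤ ∑ _σ : Placement n,
            (n.factorial - (shortCycles n k).card) ^ (m * (n - m)) * Fintype.card T :=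
          Finset.sum_le_sum fun σ _ => hsize σ
        _ = _ := by
          rw [Finset.sum_const, Finset.card_univ, Fintype.card_perm, Fintype.card_fin, smul_eq_mul]
          ring
    exact absurd (Nat.le_of_mul_le_mul_left h2 Fintype.card_pos) (not_le.2 hcount)
  obtain ⟨table, htable⟩ := hexists
  choose e he using htable
  refine ⟨⟨fun σ => (Fin.castLE hm (e σ).1, (e σ).2), tableNext hm table⟩, ?_, ?_⟩
  · intro σ h
    have h1 := congrArg Fin.val h
    have h2 := (e σ).1.2
    have h3 := (e σ).2.2
    simp only [Fin.val_castLE] at h1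
    omega
  · exact fun σ p => mem_numbersSeen_tableNext hm table (he σ) p

/-- A fallback valid for every `n ≥ 2`, so that least values of `k` exist also where the asymptotic
estimates do not apply. -/
theorem exists_strategy_openingAll {n : ℕ} (hn : 2 ≤ n) :
    ∃ S : SpyStrategy n, S.AlwaysSwaps ∧ S.SucceedsWith n := by
  refine ⟨⟨fun _ => (⟨0, by omega⟩, ⟨1, by omega⟩), fun p l =>
    if h : l.length < n then ⟨l.length, h⟩ else p⟩, fun σ => by simp, fun σ p => ?_⟩
  rw [mem_numbersSeen]
  set τ := SpyStrategy.placementAfter _ σ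
  refine ⟨τ.symm p, (τ.symm p).2, ?_⟩
  simp [length_numbersSeen]

theorem SpyStrategy.SucceedsWith.pos {n k : ℕ} {S : SpyStrategy n} (h : S.SucceedsWith k)
    (hn : 0 < n) : 0 < k := by
  rcases Nat.eq_zero_or_pos k with rfl | hk
  · simpa [numbersSeen] using h (Equiv.refl _) ⟨0, hn⟩
  · exact hk

/-! ### Choice of parameters and asymptotic estimates -/

theorem tendsto_log_natCast : Tendsto (fun n : ℕ => Real.log n) atTop atTop :=
  Real.tendsto_log_atTop.comp tendsto_natCast_atTop_atTop

/-- Combines `1 - ρ ≤ exp (-ρ)` with `n! ≤ n ^ n = exp (n log n)`. -/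
theorem factorial_mul_pow_lt_of_density {n g N : ℕ} {ρ : ℝ} (hn : 0 < n)
    (hg : n.factorial * ρ ≤ g) (hρ : n * Real.log n < ρ * N) :
    n.factorial * (n.factorial - g) ^ N < n.factorial ^ N := by
  have hn' : (0 : ℝ) < n := by exact_mod_cast hn
  have hF : (0 : ℝ) < n.factorial := by positivity
  have hN : N ≠ 0 := by
    rintro rfl
    have : 0 ≤ Real.log n := Real.log_natCast_nonneg n
    have : 0 ≤ n * Real.log n := by positivity
    simp at hρ
    linarith
  have h1 : ((n.factorial - g : ℕ) : ℝ) ≤ n.factorial * Real.exp (-ρ) := by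
    rcases le_total n.factorial g with h | h
    · rw [Nat.sub_eq_zero_of_le h, Nat.cast_zero]
      positivity
    · rw [Nat.cast_sub h]
      have := mul_le_mul_of_nonneg_left (Real.add_one_le_exp (-ρ)) hF.le
      linarith
  have h2 : (n.factorial : ℝ) ≤ Real.exp (n * Real.log n) := by
    rw [mul_comm, Real.exp_mul, Real.exp_log hn', Real.rpow_natCast]
    exact_mod_cast Nat.factorial_le_pow n
  have h3 : (n.factorial : ℝ) * (n.factorial - g : ℕ) ^ N < n.factorial ^ N :=
    calc (n.factorial : ℝ) * (n.factorial - g : ℕ) ^ N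
        ≤ Real.exp (n * Real.log n) * (n.factorial * Real.exp (-ρ)) ^ N := by gcongr
      _ = n.factorial ^ N * Real.exp (n * Real.log n - ρ * N) := by
        rw [mul_pow, ← Real.exp_nat_mul, mul_left_comm, ← Real.exp_add]
        congr 2
        ring
      _ < n.factorial ^ N * 1 := by
        gcongr
        rw [Real.exp_lt_one_iff]
        linarith
      _ = _ := mul_one _
  exact_mod_cast h3

/-- The base is at least `1 / log n = exp (-log log n)`, and the exponent is at most `log n / ((1 +
δ) log log n)`. So the density of short cycles is at least `n ^ (-1 / (1 + δ))`. -/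
theorem exp_neg_le_div_pow {n h l : ℕ} {δ : ℝ} (hδ : 0 < δ) (hn : 0 < n)
    (hlog : 1 < Real.log n) (hl : n / Real.log n ≤ l)
    (hh : (1 + δ) * (n * Real.log (Real.log n) / Real.log n) ≤ h) :
    Real.exp (-(Real.log n / (1 + δ))) ≤ ((l : ℝ) / n) ^ (n / h) := by
  set x := Real.log n
  set y := Real.log x with hy
  have hn' : (0 : ℝ) < n := by exact_mod_cast hn
  have hx : 0 < x := by linarith
  have hy0 : 0 < y := Real.log_pos hlog
  have hh0 : (0 : ℝ) < h := lt_of_lt_of_le (by positivity) hh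
  have h1 : Real.exp (-y) ≤ (l : ℝ) / n := by
    rw [Real.exp_neg, hy, Real.exp_log hx, le_div_iff₀ hn', inv_mul_eq_div]
    exact hl
  have h2 : ((n / h : ℕ) : ℝ) * y ≤ x / (1 + δ) := by
    rw [← le_div_iff₀ hy0]
    refine Nat.cast_div_le.trans ?_
    rw [div_div, div_le_div_iff₀ hh0 (by positivity)]
    rw [← mul_div_assoc, div_le_iff₀ hx] at hh
    linarith
  calc Real.exp (-(x / (1 + δ))) ≤ Real.exp ((n / h : ℕ) * -y) := by
        gcongr
        linarith
    _ = Real.exp (-y) ^ (n / h) := Real.exp_nat_mul _ _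
    _ ≤ _ := by gcongr

theorem eventually_exists_strategy {ε : ℝ} (hε : 0 < ε) :
    ∀ᶠ n : ℕ in atTop, ∃ (S : SpyStrategy n) (k : ℕ), S.AlwaysSwaps ∧ S.SucceedsWith k ∧
      (k : ℝ) ≤ (1 + ε) * (n * Real.log (Real.log n) / Real.log n) := by
  obtain ⟨δ, hδ, rfl⟩ : ∃ δ : ℝ, 0 < δ ∧ ε = 2 * δ := ⟨ε / 2, by positivity, by ring⟩
  have hc : 0 < 1 - 1 / (1 + δ) := by
    rw [sub_pos, div_lt_one (by positivity)]
    linarith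
  -- Used with `x = log n`: the density times about `n ^ 2 / (2 log n)` swaps must exceed `n log n`,
  -- and the surplus power `n ^ (1 - 1 / (1 + δ))` beats the powers of `log n`.
  have hexp : ∀ᶠ x : ℝ in atTop, 4 * x ^ 2 ≤ Real.exp ((1 - 1 / (1 + δ)) * x) := by
    filter_upwards [(isLittleO_pow_exp_pos_mul_atTop 2 hc).bound (by norm_num : (0 : ℝ) < 1 / 4)]
      with x hx
    rw [Real.norm_of_nonneg (by positivity), Real.norm_of_nonneg (by positivity)] at hx
    linarith
  filter_upwards [eventually_gt_atTop 0, tendsto_log_natCast.eventually_ge_atTop 4,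
    tendsto_log_natCast.eventually hexp,
    (Real.tendsto_log_atTop.comp tendsto_log_natCast).eventually_ge_atTop (3 / δ)]
    with n hn hx hxe hy
  simp only [Function.comp_apply] at hy
  have hn' : (0 : ℝ) < n := by exact_mod_cast hn
  have hnx : Real.exp (Real.log n) = n := Real.exp_log hn'
  have hρ := fun h l => exp_neg_le_div_pow (h := h) (l := l) hδ hn (by linarith)
  set x := Real.log n with hxdef
  set y := Real.log x
  have hx0 : 0 < x := by linarith
  have hy0 : 0 < y := Real.log_pos (by linarith)
  have h3x : 3 * x ≤ n := by
    have := Real.quadratic_le_exp_of_nonneg hx0.le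
    rw [hnx] at this
    nlinarith
  set w := (n : ℝ) / x with hw
  have hw3 : 3 ≤ w := by rwa [hw, le_div_iff₀ hx0]
  have hw4 : w ≤ n / 4 := by rw [hw]; gcongr
  set h := ⌈(1 + δ) * (n * y / x)⌉₊ with hh
  set l := ⌈w⌉₊ with hl
  have hl1 : w ≤ l := Nat.le_ceil _
  have hl2 : (l : ℝ) < w + 1 := Nat.ceil_lt_add_one (by positivity)
  have hh1 : (1 + δ) * (n * y / x) ≤ h := Nat.le_ceil _
  have hh2 : (h : ℝ) < (1 + δ) * (n * y / x) + 1 := Nat.ceil_lt_add_one (by positivity)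
  have hln2 : (l : ℝ) ≤ n / 2 := by linarith
  have hln : l ≤ n := by
    have : (l : ℝ) ≤ n := by linarith
    exact_mod_cast this
  have hh0 : 0 < h := Nat.ceil_pos.2 (by positivity)
  have hl0 : 0 < l := Nat.ceil_pos.2 (by positivity)
  have hdens := factorial_mul_pow_le_card_shortCycles hh0 hl0 hln
  have hN : w * (n / 2) ≤ (l * (n - l) : ℕ) := by
    rw [Nat.cast_mul, Nat.cast_sub hln]
    gcongr
    linarith
  have hlt : n * Real.log n < ((l : ℝ) / n) ^ (n / h) * (l * (n - l) : ℕ) := by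
    rw [← hxdef]
    calc n * x < n * (2 * x) := by nlinarith
      _ = 4 * x ^ 2 * (w / 2) := by rw [hw]; field_simp; ring
      _ ≤ Real.exp ((1 - 1 / (1 + δ)) * x) * (w / 2) := by gcongr
      _ = Real.exp (-(x / (1 + δ))) * (w * (n / 2)) := by
        rw [← hnx, show (1 - 1 / (1 + δ)) * x = -(x / (1 + δ)) + x by ring, Real.exp_add]
        ring
      _ ≤ _ := by
        gcongr
        exact hρ h l hl1 hh1
  obtain ⟨S, hS1, hS2⟩ := exists_strategy hln (factorial_mul_pow_lt_of_density hn hdens hlt)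
  refine ⟨S, _, hS1, hS2, ?_⟩
  -- The total is `l + (h + l)`. Beyond `(1 + δ) * (n * y / x)` it costs less than `2 * w + 3 ≤ 3 *
  -- w`, rounding included, which the second `δ` absorbs.
  have hwy : 3 * w ≤ δ * (n * y / x) := by
    rw [div_le_iff₀ hδ] at hy
    have : δ * (n * y / x) = w * (y * δ) := by rw [hw]; ring
    rw [this]
    nlinarith
  push_cast
  linarith

/-- If `k` were smaller, `q = n / k` would be at least `z = (2 + ε) log n / log log n`. Then `q (log
q - 1)` exceeds `2 log n`, against `q! ≤ n ^ 2`. -/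
theorem eventually_le_of_succeedsWith {ε : ℝ} (hε : 0 < ε) (hε1 : ε < 1) :
    ∀ᶠ n : ℕ in atTop, ∀ (S : SpyStrategy n) (k : ℕ), S.SucceedsWith k →
      (1 - ε) * (n * Real.log (Real.log n) / (2 * Real.log n)) ≤ k := by
  have hlog : ∀ c : ℝ, 0 < c → ∀ᶠ x : ℝ in atTop, Real.log x ≤ c * x := by
    intro c hc
    filter_upwards [Real.isLittleO_log_id_atTop.bound hc, eventually_ge_atTop 0] with x hx hx0
    rw [id, Real.norm_of_nonneg hx0] at hx
    exact (Real.le_norm_self _).trans hx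
  have hll := Real.tendsto_log_atTop.comp tendsto_log_natCast
  filter_upwards [eventually_gt_atTop 0, tendsto_log_natCast.eventually_gt_atTop 1,
    tendsto_log_natCast.eventually (hlog ε hε), hll.eventually_ge_atTop (16 / ε),
    hll.eventually (hlog (ε / 16) (by positivity))] with n hn hx hyx hy hyl S k hS
  simp only [Function.comp_apply] at hy hyl
  have hn' : (0 : ℝ) < n := by exact_mod_cast hn
  have hk := hS.pos hn
  have hk' : (0 : ℝ) < k := by exact_mod_cast hk
  have hfac := S.factorial_le_of_succeedsWith hS hk
  have hn2 : ((n : ℝ)) ^ 2 = Real.exp (2 * Real.log n) := by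
    rw [two_mul, Real.exp_add, Real.exp_log hn', pow_two]
  by_contra! hlt
  set q := n / k with hq
  set x := Real.log n
  set y := Real.log x with hydef
  have hx0 : 0 < x := by linarith
  have hy0 : 0 < y := Real.log_pos hx
  rw [div_le_iff₀ hε] at hy
  set z := 2 * x * (1 + ε / 2) / y with hz
  have hz0 : 0 < z := by positivity
  have hqz : z ≤ q := by
    have h1 : (n : ℝ) < k * (q + 1) := by exact_mod_cast Nat.lt_mul_div_succ n hk
    have h2 : 2 * x * (1 + ε) / y < q + 1 := by
      rw [div_lt_iff₀ hy0]
      rw [← mul_div_assoc, lt_div_iff₀ (by positivity)] at hlt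
      have h3 : 2 * x * (1 + ε) * k < (q + 1) * y * k :=
        calc 2 * x * (1 + ε) * k = (1 + ε) * (k * (2 * x)) := by ring
          _ < (1 + ε) * ((1 - ε) * (n * y)) := by gcongr
          _ ≤ n * y := by nlinarith [mul_pos hn' hy0, sq_nonneg ε]
          _ < k * (q + 1) * y := by gcongr
          _ = (q + 1) * y * k := by ring
      exact lt_of_mul_lt_mul_right h3 hk'.le
    have h4 : 2 * x * (1 + ε) / y = z + ε * x / y := by
      rw [hz]
      field_simp
      ring
    have h5 : 1 ≤ ε * x / y := by rwa [le_div_iff₀ hy0, one_mul]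
    linarith
  have hq0 : (0 : ℝ) < q := hz0.trans_le hqz
  have hqlog : q * (Real.log q - 1) ≤ 2 * x := by
    -- The weak Stirling bound `q ^ q ≤ q! * exp q`, from one term of the exponential series.
    have h1 := Real.pow_div_factorial_le_exp (q : ℝ) hq0.le q
    rw [div_le_iff₀ (by positivity)] at h1
    have h2 : (q : ℝ) ^ q ≤ Real.exp (q + 2 * x) := by
      rw [Real.exp_add, ← hn2]
      refine h1.trans ?_
      gcongr
      exact_mod_cast hfac
    have h3 := Real.log_le_log (by positivity) h2
    rw [Real.log_exp, Real.log_pow] at h3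
    linarith
  have hzlog : (1 - ε / 8) * y ≤ Real.log z - 1 := by
    have h1 : Real.log (x / y) ≤ Real.log z := by
      refine Real.log_le_log (by positivity) ?_
      rw [hz]
      gcongr
      nlinarith
    rw [Real.log_div hx0.ne' hy0.ne', ← hydef] at h1
    linarith
  have hlogq : Real.log z ≤ Real.log q := Real.log_le_log hz0 hqz
  have h8 : 0 ≤ (1 - ε / 8) * y := mul_nonneg (by linarith) hy0.le
  have hfinal : z * ((1 - ε / 8) * y) ≤ 2 * x :=
    (mul_le_mul hqz (by linarith) h8 hq0.le).trans hqlog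
  have hzy : z * ((1 - ε / 8) * y) = 2 * x * ((1 + ε / 2) * (1 - ε / 8)) := by
    rw [hz]
    field_simp
  rw [hzy] at hfinal
  have : 1 < (1 + ε / 2) * (1 - ε / 8) := by nlinarith
  nlinarith

/-- The error functions are quotients by the main term, which vanishes only at `n = e`, not an
integer. -/
theorem log_log_natCast_ne_zero {n : ℕ} (hn : 2 ≤ n) : Real.log (Real.log n) ≠ 0 := by
  have hlog : 0 < Real.log n := Real.log_pos (by exact_mod_cast hn)
  refine Real.log_ne_zero_of_pos_of_ne_one hlog fun h => ?_
  have hexp : Real.exp 1 = n := by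
    rw [← h, Real.exp_log (by positivity)]
  have h1 := Real.exp_one_gt_d9
  have h2 := Real.exp_one_lt_d9
  have h3 : 2 < n := by
    have : (2 : ℝ) < n := by linarith
    exact_mod_cast this
  have h4 : n < 3 := by
    have : (n : ℝ) < 3 := by linarith
    exact_mod_cast this
  omega

theorem tendsto_main_term :
    Tendsto (fun n : ℕ => n * Real.log (Real.log n) / Real.log n) atTop atTop := by
  have h1 : Tendsto (fun n : ℕ => Real.log (Real.log n)) atTop atTop :=
    Real.tendsto_log_atTop.comp tendsto_log_natCast
  refine tendsto_atTop_mono' _ ?_ h1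
  filter_upwards [eventually_gt_atTop 0, tendsto_log_natCast.eventually_gt_atTop 1] with n hn hx
  have hn' : (0 : ℝ) < n := by exact_mod_cast hn
  rw [le_div_iff₀ (by linarith), mul_comm]
  gcongr
  · exact (Real.log_pos hx).le
  · exact Real.log_le_self hn'.le

/-! ### From estimates for each `ε` to error functions -/

theorem exists_asymptotically_good_strategies :
    ∃ (k : ℕ → ℕ) (f : ℕ → ℝ), Tendsto f atTop (𝓝 0) ∧
      ∀ n : ℕ, 2 ≤ n →
        (k n : ℝ) = (n : ℝ) * Real.log (Real.log (n : ℝ)) / Real.log (n : ℝ) * (1 + f n) ∧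
        ∃ S : SpyStrategy n, S.AlwaysSwaps ∧ S.SucceedsWith (k n) := by
  classical
  set b : ℕ → ℝ := fun n => n * Real.log (Real.log n) / Real.log n with hb
  have hex : ∀ n : ℕ, ∃ k : ℕ, 2 ≤ n → ∃ S : SpyStrategy n, S.AlwaysSwaps ∧ S.SucceedsWith k :=
    fun n => ⟨n, exists_strategy_openingAll⟩
  -- The least feasible number of drawers might lie well below `b n`; raising it to `⌈b n⌉₊` gives
  -- an exact asymptotic and preserves success.
  set k : ℕ → ℕ := fun n => max (Nat.find (hex n)) ⌈b n⌉₊ with hk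
  refine ⟨k, fun n => k n / b n - 1, ?_, fun n hn => ⟨?_, ?_⟩⟩
  · rw [Metric.tendsto_atTop']
    intro ε hε
    obtain ⟨N, hN⟩ := (((eventually_exists_strategy (half_pos hε)).and
      (tendsto_main_term.eventually_gt_atTop (2 / ε))).and
        (tendsto_main_term.eventually_gt_atTop 0)).exists_forall_of_atTop
    refine ⟨N, fun n hn => ?_⟩
    obtain ⟨⟨⟨S, j, hS1, hS2, hj⟩, h2⟩, h0⟩ := hN n hn.le
    rw [div_lt_iff₀ hε] at h2
    change (j : ℝ) ≤ (1 + ε / 2) * b n at hj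
    change 2 < b n * ε at h2
    change 0 < b n at h0
    have hle : (⌈b n⌉₊ : ℝ) < b n + 1 := Nat.ceil_lt_add_one h0.le
    have hge : b n ≤ ⌈b n⌉₊ := Nat.le_ceil _
    have hfind : Nat.find (hex n) ≤ j := Nat.find_min' _ fun _ => ⟨S, hS1, hS2⟩
    have hk1 : b n ≤ k n := hge.trans (by exact_mod_cast le_max_right _ _)
    have hk2 : (k n : ℝ) < b n * (1 + ε) := by
      rw [hk, Nat.cast_max]
      refine max_lt ?_ ?_
      · have : (Nat.find (hex n) : ℝ) ≤ j := by exact_mod_cast hfind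
        nlinarith
      · nlinarith
    have h3 : 1 ≤ k n / b n := by rwa [le_div_iff₀ h0, one_mul]
    have h4 : k n / b n < 1 + ε := by rwa [div_lt_iff₀ h0, mul_comm]
    rw [Real.dist_eq, sub_zero, abs_of_nonneg (by linarith)]
    linarith
  · have h1 : Real.log n ≠ 0 := (Real.log_pos (by exact_mod_cast hn)).ne'
    have h2 := log_log_natCast_ne_zero hn
    have h3 : b n ≠ 0 := div_ne_zero (mul_ne_zero (by positivity) h2) h1
    change (k n : ℝ) = b n * (1 + (k n / b n - 1))
    field_simp
    ring
  · obtain ⟨S, hS1, hS2⟩ := Nat.find_spec (hex n) hn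
    exact ⟨S, hS1, hS2.mono (le_max_left _ _)⟩

theorem exists_asymptotic_lower_bound :
    ∃ g : ℕ → ℝ, Tendsto g atTop (𝓝 0) ∧
      ∀ n : ℕ, 2 ≤ n → ∀ (S : SpyStrategy n) (k : ℕ), S.SucceedsWith k →
        (n : ℝ) * Real.log (Real.log (n : ℝ)) / (2 * Real.log (n : ℝ)) * (1 + g n) ≤ (k : ℝ) := by
  classical
  set b : ℕ → ℝ := fun n => n * Real.log (Real.log n) / (2 * Real.log n) with hb
  have hb0 : ∀ᶠ n in atTop, 0 < b n := by
    filter_upwards [tendsto_main_term.eventually_gt_atTop 0] with n hn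
    have : b n = n * Real.log (Real.log n) / Real.log n / 2 := by
      rw [hb]
      ring
    linarith
  have hex : ∀ n : ℕ, ∃ k : ℕ, 2 ≤ n → ∃ S : SpyStrategy n, S.SucceedsWith k :=
    fun n => ⟨n, fun hn => (exists_strategy_openingAll hn).imp fun _ h => h.2⟩
  set κ : ℕ → ℕ := fun n => Nat.find (hex n) with hκ
  -- The least feasible `κ n` may stay well above `b n`, so the relative error is cut off at `0`;
  -- only its negative part must vanish in the limit.
  refine ⟨fun n => min 0 (κ n / b n - 1), ?_, fun n hn S k hS => ?_⟩
  · rw [Metric.tendsto_atTop']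
    intro ε hε
    obtain ⟨δ, hδ, hδ1, hδε⟩ : ∃ δ : ℝ, 0 < δ ∧ δ < 1 ∧ δ < ε :=
      ⟨min (1 / 2) (ε / 2), by positivity, by
        have := min_le_left (1 / 2) (ε / 2)
        linarith, by
        have := min_le_right (1 / 2) (ε / 2)
        linarith⟩
    obtain ⟨N, hN⟩ := (((eventually_le_of_succeedsWith hδ hδ1).and hb0).and
      (eventually_ge_atTop 2)).exists_forall_of_atTop
    refine ⟨N, fun n hn => ?_⟩
    obtain ⟨⟨h1, h0⟩, hn2⟩ := hN n hn.le
    obtain ⟨S, hS⟩ := Nat.find_spec (hex n) hn2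
    have h2 : 1 - δ ≤ κ n / b n := by
      rw [le_div_iff₀ h0]
      exact h1 S _ hS
    rw [Real.dist_eq, sub_zero, abs_lt]
    exact ⟨lt_min (by linarith) (by linarith), (min_le_left _ _).trans_lt hε⟩
  · have hκk : (κ n : ℝ) ≤ k := by
      exact_mod_cast Nat.find_min' (hex n) fun _ => ⟨S, hS⟩
    have h1 : 0 < Real.log n := Real.log_pos (by exact_mod_cast hn)
    have hbn : b n ≠ 0 := div_ne_zero (mul_ne_zero (by positivity) (log_log_natCast_ne_zero hn))
      (by positivity)
    have hcancel : b n * (1 + (κ n / b n - 1)) = κ n := by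
      field_simp
      ring
    change b n * (1 + min 0 (κ n / b n - 1)) ≤ k
    -- For `n = 2` the main term is negative; there the minimum is the quotient itself and the bound
    -- reads `κ n ≤ k`.
    rcases hbn.lt_or_gt with hneg | hpos
    · have : κ n / b n - 1 ≤ 0 := by
        have := div_nonpos_of_nonneg_of_nonpos (Nat.cast_nonneg (κ n)) hneg.le
        linarith
      rw [min_eq_right this, hcancel]
      exact hκk
    · refine le_trans (mul_le_mul_of_nonneg_left ?_ hpos.le) (hcancel.le.trans hκk)
      have := min_le_right 0 (κ n / b n - 1)
      linarith

theorem theorem1 :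
    (∃ (k : ℕ → ℕ) (f : ℕ → ℝ), Tendsto f atTop (𝓝 0) ∧
      ∀ n : ℕ, 2 ≤ n →
        (k n : ℝ) = (n : ℝ) * Real.log (Real.log (n : ℝ)) / Real.log (n : ℝ) * (1 + f n) ∧
        ∃ S : SpyStrategy n, S.AlwaysSwaps ∧ S.SucceedsWith (k n)) ∧
    (∃ g : ℕ → ℝ, Tendsto g atTop (𝓝 0) ∧
      ∀ n : ℕ, 2 ≤ n → ∀ (S : SpyStrategy n) (k : ℕ), S.SucceedsWith k →
        (n : ℝ) * Real.log (Real.log (n : ℝ)) / (2 * Real.log (n : ℝ)) * (1 + g n) ≤ (k : ℝ)) :=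
  ⟨exists_asymptotically_good_strategies, exists_asymptotic_lower_bound⟩
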